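/- An affine VASS $\mathcal V=(d,Q,T)$ consists of a number $d\ge 1$ of counters, a finite set $Q$ of control-states and a finite set $T\subseteq Q\times\mathbb Z^{d\times d}\times\mathbb Z^d\times Q$ of transitions. A configuration is a pair $q(\vec v)$ with $q\in Q$, $\vec v\in\mathbb Z^d$. Write $p(\vec u)\to_{\mathbb N}q(\vec v)$ if $\vec u,\vec v\in\mathbb N^d$ and $\vec v=\mathbf A\vec u+\vec b$ for some $(p,\mathbf A,\vec b,q)\in T$, and let $\to^*_{\mathbb N}$ be the reflexive-transitive closure of $\to_{\mathbb N}$. A class is a set $\mathcal C\subseteq\bigcup_{k\ge 1}\mathbb Z^{k\times k}$ of matrices that contains the identity matrix $\mathbf I_n$ for every $n\ge 1$; that contains the product of any two of its members of the same dimension; and that, for every $\mathbf A\in\mathcal C$ of dimension $k$, contains $\mathbf P_\sigma\mathbf A\mathbf P_{\sigma^{-1}}$ for every permutation $\sigma$ of $\{1,\dots,k\}$ with permutation matrix $\mathbf P_\sigma$, and $\begin{pmatrix}\mathbf A&\mathbf 0\\ \mathbf 0&\mathbf I_n\end{pmatrix}$ for every $n\ge 1$. For a fixed class $\mathcal C$,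 the reachability problem $\mathrm{Reach}(\mathcal C)$ is the following: the input is an affine VASS $\mathcal V$ such that all matrices on its transitions are in $\mathcal C$, together with two configurations $p(\vec u)$ and $q(\vec v)$ of $\mathcal V$; the question is whether $p(\vec u)\to^*_{\mathbb N}q(\vec v)$ in $\mathcal V$. **Proposition.** For every class $\mathcal C$ that contains a matrix with some negative entry, $\mathrm{Reach}(\mathcal C)$ is undecidable: no algorithm (partial recursive function) halts with the correct answer on every such input. -/

import Mathlib

/-- A transition `(p, A, b, q)` of an affine VASS with `d` counters and control-states `Q`. -/
structure Transition (d : ℕ) (Q : Type*) where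
  src : Q
  mat : Matrix (Fin d) (Fin d) ℤ
  vec : Fin d → ℤ
  tgt : Q

/-- An affine VASS with `d ≥ 1` counters, a finite set `Q` of control-states, and
finitely many transitions. -/
structure AffineVASS (d : ℕ) (Q : Type*) where
  dim_pos : 1 ≤ d
  finite_states : Finite Q
  transitions : Set (Transition d Q)
  finite_transitions : transitions.Finite

/-- A configuration `q(v)`: a control-state together with a vector of integers. -/
abbrev Configuration (d : ℕ) (Q : Type*) : Type _ := Q × (Fin d → ℤ)

namespace AffineVASS

variable {d : ℕ} {Q : Type*}

/-- `p(u) →ₜ q(v)` under the semantics over the natural numbers: both vectors are nonnegative,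
`t` leads from `p` to `q`, and `v = A * u + b` where `A`, `b` are the matrix and vector of `t`. -/
def NStepVia (t : Transition d Q) (c c' : Configuration d Q) : Prop :=
  (∀ i, 0 ≤ c.2 i) ∧ (∀ i, 0 ≤ c'.2 i) ∧ t.src = c.1 ∧ t.tgt = c'.1 ∧
    c'.2 = t.mat.mulVec c.2 + t.vec

/-- One step of `V` under the semantics over the natural numbers. -/
def NStep (V : AffineVASS d Q) (c c' : Configuration d Q) : Prop :=
  ∃ t ∈ V.transitions, NStepVia t c c'

/-- `c →* c'` in `V` under the semantics over the natural numbers. -/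
def NReach (V : AffineVASS d Q) (c c' : Configuration d Q) : Prop :=
  Relation.ReflTransGen V.NStep c c'

end AffineVASS

/-- The block diagonal matrix with blocks `A` and the `n × n` identity matrix. -/
def extendMatrix {k : ℕ} (A : Matrix (Fin k) (Fin k) ℤ) (n : ℕ) :
    Matrix (Fin (k + n)) (Fin (k + n)) ℤ :=
  Matrix.reindex finSumFinEquiv finSumFinEquiv
    (Matrix.fromBlocks A 0 0 (1 : Matrix (Fin n) (Fin n) ℤ))

/-- The matrix `P_σ * A * P_{σ⁻¹}`, that is, `A` with its counters renamed by `σ`. -/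
def renameMatrix {k : ℕ} (A : Matrix (Fin k) (Fin k) ℤ) (σ : Equiv.Perm (Fin k)) :
    Matrix (Fin k) (Fin k) ℤ :=
  σ.permMatrix ℤ * A * (σ⁻¹).permMatrix ℤ

/-- A set of integer square matrices is given by the sets `C k` of its `k × k` members. It is a
class if its members have dimension at least one, and if it is closed under renaming of counters,
extension to larger dimensions and products, and contains all identity matrices. -/
structure IsMatrixClass (C : (k : ℕ) → Set (Matrix (Fin k) (Fin k) ℤ)) : Prop where
  dim_pos : ∀ {k : ℕ} {A : Matrix (Fin k) (Fin k) ℤ}, A ∈ C k → 1 ≤ k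
  rename_mem : ∀ {k : ℕ} {A : Matrix (Fin k) (Fin k) ℤ}, A ∈ C k →
    ∀ σ : Equiv.Perm (Fin k), renameMatrix A σ ∈ C k
  extend_mem : ∀ {k : ℕ} {A : Matrix (Fin k) (Fin k) ℤ}, A ∈ C k →
    ∀ n : ℕ, 1 ≤ n → extendMatrix A n ∈ C (k + n)
  one_mem : ∀ n : ℕ, 1 ≤ n → (1 : Matrix (Fin n) (Fin n) ℤ) ∈ C n
  mul_mem : ∀ {k : ℕ} {A B : Matrix (Fin k) (Fin k) ℤ}, A ∈ C k → B ∈ C k → A * B ∈ C k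

/-- An affine VASS belongs to `C` if all matrices on its transitions belong to `C`. -/
def AffineVASS.BelongsTo {d : ℕ} {Q : Type*} (V : AffineVASS d Q)
    (C : (k : ℕ) → Set (Matrix (Fin k) (Fin k) ℤ)) : Prop :=
  ∀ t ∈ V.transitions, t.mat ∈ C d

/-- An input of a reachability problem: an affine VASS, whose control-states are numbered and
whose transitions are listed, and two of its configurations. -/
structure ReachInput where
  dim : ℕ
  dim_pos : 1 ≤ dim
  numStates : ℕ
  transitionList : List (Transition dim (Fin numStates))
  source : Configuration dim (Fin numStates)
  target : Configuration dim (Fin numStates)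

/-- The affine VASS of an input. -/
def ReachInput.vass (I : ReachInput) : AffineVASS I.dim (Fin I.numStates) where
  dim_pos := I.dim_pos
  finite_states := inferInstance
  transitions := {t | t ∈ I.transitionList}
  finite_transitions := I.transitionList.finite_toSet

/-- Finite data over the integers to write inputs down for an algorithm: the number of counters,
the number of control-states, the transitions, and two configurations. -/
abbrev ReachCode : Type :=
  ℕ × ℕ × List (ℕ × List (List ℤ) × List ℤ × ℕ) × (ℕ × List ℤ) × (ℕ × List ℤ)

/-- A transition written as finite data; its matrix is written as the list of its rows. -/
def Transition.code {d n : ℕ} (t : Transition d (Fin n)) : ℕ × List (List ℤ) × List ℤ × ℕ :=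
  ((t.src : ℕ), List.ofFn (fun i => List.ofFn (fun j => t.mat i j)), List.ofFn t.vec, (t.tgt : ℕ))

/-- A configuration written as finite data. -/
def configurationCode {d n : ℕ} (c : Configuration d (Fin n)) : ℕ × List ℤ :=
  ((c.1 : ℕ), List.ofFn c.2)

/-- An input written as finite data. -/
def ReachInput.code (I : ReachInput) : ReachCode :=
  (I.dim, I.numStates, I.transitionList.map Transition.code,
    configurationCode I.source, configurationCode I.target)

/-- The problem with inputs `x : ι` satisfying `IsInput x`, presented to the algorithm as `code x`,
and with the question whether `Yes x` holds, is decidable: some partial recursive function halts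
with the correct answer on all inputs. Nothing is required on data that present no input. -/
def DecidableProblem {ι κ : Type*} [Primcodable κ] (code : ι → κ) (IsInput Yes : ι → Prop) : Prop :=
  ∃ f : κ →. Bool, Partrec f ∧ ∀ x, IsInput x → ∃ b ∈ f (code x), (b = true ↔ Yes x)

/-- `Reach(C)` is decidable. Its inputs are an affine VASS that belongs to `C` and two
configurations; the question is whether the second configuration is reachable from the first
under the semantics over the natural numbers. -/
def ReachDecidable (C : (k : ℕ) → Set (Matrix (Fin k) (Fin k) ℤ)) : Prop :=
  DecidableProblem ReachInput.code
    (fun I : ReachInput => I.vass.BelongsTo C)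
    (fun I : ReachInput => I.vass.NReach I.source I.target)

/-
A partial recursive function is computed by a nondeterministic program over counters with
increments, decrements and zero tests, whose control-flow graph an affine VASS can follow: only the
zero tests need matrices other than the identity. Let `A ∈ C` have the entry `A i₀ j < 0`. The VASS
has as many additional counters as `A` has rows, and they are always zero. To test counter `c`,
apply `A` to the additional counters, with `c` in the role of counter `j`. If `c` is zero, nothing
changes. If `c` is positive, then the entry `i₀` of the result, which is stored in `c` itself when
`i₀ = j`, is negative and the step is blocked. Hence the halting problem reduces to `Reach(C)`.
-/

open Relation

/-- The contents of countably many registers holding natural numbers. -/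
abbrev Registers : Type := ℕ → ℕ

/-- The instructions of counter programs. -/
inductive CounterInstr
  | skip
  | inc (i : ℕ)
  | dec (i : ℕ)
  | test (i : ℕ)
  deriving DecidableEq

/-- The effect of an instruction on the registers. The equation for `dec i` has no solution `t`
when register `i` is zero, so that `dec` blocks there, as a counter of a VASS does. -/
def CounterInstr.Exec : CounterInstr → Registers → Registers → Prop
  | skip, s, t => t = s
  | inc i, s, t => t = s + Pi.single i 1
  | dec i, s, t => s = t + Pi.single i 1
  | test i, s, t => s i = 0 ∧ t = s

theorem CounterInstr.exists_exec_dec {i : ℕ} {s : Registers} (hs : 1 ≤ s i) :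
    ∃ t, (dec i).Exec s t :=
  ⟨s - Pi.single i 1, (tsub_add_cancel_of_le (update_le_iff.2 ⟨hs, by simp⟩)).symm⟩

/-- Nondeterministic counter programs: the regular expressions over instructions that are built
from sequencing and iteration. -/
inductive CounterProgram
  | act (a : CounterInstr)
  | seq (P Q : CounterProgram)
  | star (P : CounterProgram)
  deriving DecidableEq

namespace CounterProgram

/-- The input-output relation of a program. -/
def Sem : CounterProgram → Registers → Registers → Prop
  | act a => a.Exec
  | seq P Q => Comp P.Sem Q.Sem
  | star P => ReflTransGen P.Sem

/-- Correctness of a program with respect to a partial value: started in `s`, it can terminate if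
`o` is defined, and it terminates only in registers that represent a value of `o` according to
`R`. -/
def Returns {α : Type*} (P : CounterProgram) (s : Registers) (o : Part α)
    (R : α → Registers → Prop) : Prop :=
  (∀ t, P.Sem s t → ∃ a ∈ o, R a t) ∧ (o.Dom → ∃ t, P.Sem s t)

/-- Total correctness of a program with respect to a postcondition. -/
abbrev Ensures (P : CounterProgram) (s : Registers) (R : Registers → Prop) : Prop :=
  P.Returns s (Part.some ()) fun _ => R

section Rules

variable {α β : Type*} {P Q : CounterProgram} {s : Registers} {o : Part α}
  {R : α → Registers → Prop} {S T : Registers → Prop}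

theorem ensures_iff : P.Ensures s S ↔ (∀ t, P.Sem s t → S t) ∧ ∃ t, P.Sem s t := by
  simp [Ensures, Returns]

theorem Returns.map (h : P.Returns s o R) (f : α → β) {R' : β → Registers → Prop}
    (hR : ∀ a t, R a t → R' (f a) t) : P.Returns s (o.map f) R' := by
  refine ⟨fun t ht => ?_, h.2⟩
  obtain ⟨a, ha, hat⟩ := h.1 t ht
  exact ⟨f a, Part.mem_map f ha, hR a t hat⟩

theorem Returns.mono (h : P.Returns s o R) {R' : α → Registers → Prop}
    (hR : ∀ a t, R a t → R' a t) : P.Returns s o R' :=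
  ⟨fun t ht => let ⟨a, ha, hat⟩ := h.1 t ht; ⟨a, ha, hR a t hat⟩, h.2⟩

theorem Returns.ensures {a : α} (h : P.Returns s (Part.some a) R) : P.Ensures s (R a) := by
  simpa [Returns] using h

theorem Ensures.returns (h : P.Ensures s S) {a : α} (hR : ∀ t, S t → R a t) :
    P.Returns s (Part.some a) R := by
  simpa using h.map (fun _ => a) fun _ => hR

theorem Returns.seq (hP : P.Returns s o R) {o' : α → Part β} {R' : β → Registers → Prop}
    (hQ : ∀ a u, R a u → Q.Returns u (o' a) R') : (seq P Q).Returns s (o.bind o') R' := by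
  constructor
  · rintro t ⟨u, hPu, hQt⟩
    obtain ⟨a, ha, hau⟩ := hP.1 u hPu
    obtain ⟨b, hb, hbt⟩ := (hQ a u hau).1 t hQt
    exact ⟨b, Part.mem_bind ha hb, hbt⟩
  · intro hdom
    obtain ⟨b, hb⟩ := Part.dom_iff_mem.1 hdom
    obtain ⟨a, ha, hb⟩ := Part.mem_bind_iff.1 hb
    obtain ⟨u, hPu⟩ := hP.2 (Part.dom_iff_mem.2 ⟨a, ha⟩)
    obtain ⟨a', ha', hau⟩ := hP.1 u hPu
    obtain rfl := Part.mem_unique ha ha'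
    obtain ⟨t, hQt⟩ := (hQ a u hau).2 (Part.dom_iff_mem.2 ⟨b, hb⟩)
    exact ⟨t, u, hPu, hQt⟩

theorem Ensures.seq (hP : P.Ensures s S) (hQ : ∀ u, S u → Q.Returns u o R) :
    (seq P Q).Returns s o R := by
  simpa using Returns.seq hP fun _ => hQ

theorem ensures_skip : (act .skip).Ensures s (· = s) :=
  ensures_iff.2 ⟨fun _ ht => ht, s, rfl⟩

theorem ensures_inc (i : ℕ) : (act (.inc i)).Ensures s (· = s + Pi.single i 1) :=
  ensures_iff.2 ⟨fun _ ht => ht, _, rfl⟩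

/-- The program `while i ≠ 0 do (i := i - 1; P)`. -/
def loop (i : ℕ) (P : CounterProgram) : CounterProgram :=
  seq (star (seq (act (.dec i)) P)) (act (.test i))

/-- The number of rounds of the loop is found by unbounded search: if `I k` is an invariant after
`k` rounds that fixes the value `c k` of register `i`, the loop ends after the first `k` rounds
with `c k = 0`. -/
theorem Returns.loop {i : ℕ} {I : ℕ → Registers → Prop} {c : ℕ → ℕ} (h0 : I 0 s)
    (hc : ∀ k u, I k u → u i = c k)
    (hP : ∀ k u, I k (u + Pi.single i 1) → P.Ensures u (I (k + 1))) :
    (loop i P).Returns s (Nat.rfind fun k => Part.some (decide (c k = 0))) I := by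
  have mem_rfind (k : ℕ) : k ∈ Nat.rfind (fun k => Part.some (decide (c k = 0))) ↔
      c k = 0 ∧ ∀ j < k, c j ≠ 0 := Nat.mem_rfind.trans (by simp)
  let round := CounterProgram.seq (act (.dec i)) P
  have sound {u : Registers} (hu : ReflTransGen round.Sem s u) :
      ∃ k, I k u ∧ ∀ j < k, c j ≠ 0 := by
    induction hu with
    | refl => exact ⟨0, h0, by simp⟩
    | tail _ hround ih =>
      obtain ⟨w, rfl, hw⟩ := hround
      obtain ⟨k, hk, hpos⟩ := ih
      have hck : c k = w i + 1 := by simpa using (hc k _ hk).symm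
      exact ⟨k + 1, (ensures_iff.1 (hP k w hk)).1 _ hw, by grind⟩
  have complete (k : ℕ) (hpos : ∀ j < k, c j ≠ 0) : ∃ u, I k u ∧ ReflTransGen round.Sem s u := by
    induction k with
    | zero => exact ⟨s, h0, .refl⟩
    | succ k ih =>
      obtain ⟨u, hu, hsu⟩ := ih fun j hj => hpos j (hj.trans k.lt_succ_self)
      have hui : 1 ≤ u i := Nat.one_le_iff_ne_zero.2 (hc k u hu ▸ hpos k k.lt_succ_self)
      obtain ⟨w, rfl⟩ := CounterInstr.exists_exec_dec hui
      obtain ⟨hI, t, ht⟩ := ensures_iff.1 (hP k w hu)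
      exact ⟨t, hI t ht, hsu.tail ⟨w, rfl, ht⟩⟩
  constructor
  · rintro t ⟨u, hu, hzero, rfl⟩
    obtain ⟨k, hk, hpos⟩ := sound hu
    exact ⟨k, (mem_rfind k).2 ⟨hc k t hk ▸ hzero, hpos⟩, hk⟩
  · intro hdom
    obtain ⟨k, hk⟩ := Part.dom_iff_mem.1 hdom
    obtain ⟨hzero, hpos⟩ := (mem_rfind k).1 hk
    obtain ⟨u, hu, hsu⟩ := complete k hpos
    exact ⟨u, u, hsu, (hc k u hu).trans hzero, rfl⟩

theorem Ensures.loop {i : ℕ} {I : ℕ → Registers → Prop} (h0 : I 0 s)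
    (hc : ∀ k u, I k u → u i = s i - k)
    (hP : ∀ k u, I k (u + Pi.single i 1) → P.Ensures u (I (k + 1))) :
    (loop i P).Ensures s (I (s i)) := by
  have rounds : Nat.rfind (fun k => Part.some (decide (s i - k = 0))) = Part.some (s i) :=
    Part.eq_some_iff.2 (Nat.mem_rfind.2 (by simp; omega))
  exact (rounds ▸ Returns.loop h0 hc hP).ensures

end Rules

section Registers

variable {s : Registers}

/-- Increment each register in a list, as often as it occurs. -/
def incAll : List ℕ → CounterProgram
  | [] => act .skip
  | y :: ys => seq (act (.inc y)) (incAll ys)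

theorem ensures_incAll (ys : List ℕ) :
    (incAll ys).Ensures s (· = fun r => s r + ys.count r) := by
  induction ys generalizing s with
  | nil => exact ensures_skip.mono fun _ t ht => by simp [ht]
  | cons y ys ih =>
    refine (ensures_inc y).seq fun u hu => ih.mono fun _ t ht => ?_
    ext r
    simp only [ht, hu, Pi.add_apply, Pi.single_apply, List.count_cons]
    grind

/-- Empty register `x`, adding its value to each register in a list. -/
def pour (x : ℕ) (ys : List ℕ) : CounterProgram :=
  loop x (incAll ys)

theorem ensures_pour {x : ℕ} {ys : List ℕ} (hx : x ∉ ys) :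
    (pour x ys).Ensures s fun t => t x = 0 ∧ ∀ r ≠ x, t r = s r + s x * ys.count r := by
  have hcount : ys.count x = 0 := List.count_eq_zero.2 hx
  have := Ensures.loop (P := incAll ys) (i := x) (s := s)
    (I := fun k u => u x = s x - k ∧ ∀ r ≠ x, u r = s r + k * ys.count r)
    (by simp) (fun k u hu => hu.1) fun k u hu => (ensures_incAll ys).mono fun _ t ht => by
      simp only [Pi.add_apply, Pi.single_eq_same] at hu
      refine ⟨by grind, fun r hr => ?_⟩
      have := hu.2 r hr
      simp only [Pi.single_eq_of_ne hr] at this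
      grind
  simpa [pour] using this

/-- Set register `x` to zero. -/
def clear (x : ℕ) : CounterProgram :=
  pour x []

theorem ensures_clear (x : ℕ) : (clear x).Ensures s fun t => t x = 0 ∧ ∀ r ≠ x, t r = s r := by
  simpa [clear] using ensures_pour (x := x) (ys := []) (s := s) (by simp)

/-- Assign the value of register `x` to register `y`, emptying `x`. -/
def move (x y : ℕ) : CounterProgram :=
  seq (clear y) (pour x [y])

theorem ensures_move {x y : ℕ} (hxy : x ≠ y) :
    (move x y).Ensures s fun t => t y = s x ∧ ∀ r ≠ x, r ≠ y → t r = s r := by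
  refine (ensures_clear y).seq fun u hu => (ensures_pour (by simpa)).mono fun _ t ht => ?_
  grind

/-- Assign the value of register `x` to register `y`, with `z` as an auxiliary register. -/
def copy (x y z : ℕ) : CounterProgram :=
  seq (clear y) (seq (clear z) (seq (pour x [y, z]) (pour z [x])))

theorem ensures_copy {x y z : ℕ} (hxy : x ≠ y) (hxz : x ≠ z) (hyz : y ≠ z) :
    (copy x y z).Ensures s fun t => t y = s x ∧ ∀ r ≠ y, r ≠ z → t r = s r := by
  refine (ensures_clear y).seq fun u hu => (ensures_clear z).seq fun v hv =>
    (ensures_pour (by simp [hxy, hxz])).seq fun w hw =>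
    (ensures_pour (by simpa using hxz.symm)).mono fun _ t ht => ?_
  grind

/-- Set the first `m` registers to zero. -/
def drain : ℕ → CounterProgram
  | 0 => act .skip
  | m + 1 => seq (drain m) (clear m)

theorem ensures_drain (m : ℕ) : (drain m).Ensures s fun t => ∀ r < m, t r = 0 := by
  induction m with
  | zero => exact ensures_skip.mono (by simp)
  | succ m ih => exact ih.seq fun u hu => (ensures_clear m).mono fun _ t ht => by grind

end Registers

/-- Computability by counter programs: for all argument registers and every bound `b` on them, some
program assigns the value of `f` to register `b` and preserves the registers below `b`. The
registers above `b` are its working space; they need not be zero at the start. -/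
def Computes {n : ℕ} (f : List.Vector ℕ n →. ℕ) : Prop :=
  ∀ (args : Fin n → ℕ) (b : ℕ), (∀ i, args i < b) → ∃ P : CounterProgram,
    ∀ (s : Registers) (v : List.Vector ℕ n), (∀ i, s (args i) = v.get i) →
      P.Returns s (f v) fun y t => t b = y ∧ ∀ r < b, t r = s r

theorem computes_zero : Computes (fun _ : List.Vector ℕ 0 => Part.some 0) := fun _ b _ =>
  ⟨clear b, fun _ _ _ => (ensures_clear b).returns fun _ ht => ⟨ht.1, fun r hr => ht.2 r hr.ne⟩⟩

theorem computes_get {n : ℕ} (i : Fin n) :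
    Computes (fun v : List.Vector ℕ n => Part.some (v.get i)) := by
  intro args b hb
  refine ⟨copy (args i) b (b + 1), fun s v hv => ?_⟩
  have hbi := hb i
  refine (ensures_copy hbi.ne (by omega) (by omega)).returns fun t ht => ?_
  exact ⟨ht.1.trans (hv i), fun r hr => ht.2 r (by omega) (by omega)⟩

theorem computes_succ : Computes (fun v : List.Vector ℕ 1 => Part.some v.head.succ) := by
  intro args b hb
  obtain ⟨P, hP⟩ := computes_get (0 : Fin 1) args b hb
  refine ⟨seq P (act (.inc b)), fun s v hv => (hP s v hv).ensures.seq fun u hu =>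
    (ensures_inc b).returns ?_⟩
  rintro t rfl
  refine ⟨by simp [hu.1], fun r hr => ?_⟩
  simpa [hr.ne] using hu.2 r hr

theorem Computes.exists_mOfFn {m n : ℕ} {g : Fin n → List.Vector ℕ m →. ℕ}
    (hg : ∀ i, Computes (g i)) {args : Fin m → ℕ} {b : ℕ} (hb : ∀ i, args i < b) :
    ∃ P : CounterProgram, ∀ (s : Registers) (v : List.Vector ℕ m), (∀ i, s (args i) = v.get i) →
      P.Returns s (List.Vector.mOfFn fun i => g i v) fun w t =>
        (∀ i : Fin n, t (b + i) = w.get i) ∧ ∀ r < b, t r = s r := by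
  induction n generalizing b with
  | zero =>
    exact ⟨act .skip, fun s v _ =>
      ensures_skip.returns fun t ht => ⟨fun i => i.elim0, by simp [ht]⟩⟩
  | succ n ih =>
    obtain ⟨P, hP⟩ := hg 0 args b hb
    obtain ⟨Q, hQ⟩ := ih (fun i => hg i.succ) (b := b + 1) fun i => (hb i).trans b.lt_succ_self
    refine ⟨seq P Q, fun s v hv => (hP s v hv).seq fun y u hu => ?_⟩
    have hargs (i : Fin m) : u (args i) = v.get i := (hu.2 _ (hb i)).trans (hv i)
    simp only [Part.pure_eq_some, Part.bind_eq_bind, Part.bind_some_eq_map]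
    refine (hQ u v hargs).map (y ::ᵥ ·) fun w t ht =>
      ⟨Fin.forall_fin_succ.2 ⟨?_, fun i => ?_⟩, fun r hr => ?_⟩
    · simpa using (ht.2 b b.lt_succ_self).trans hu.1
    · simpa [add_right_comm, add_assoc] using ht.1 i
    · exact (ht.2 r (by omega)).trans (hu.2 r hr)

theorem Computes.comp {m n : ℕ} {f : List.Vector ℕ n →. ℕ} {g : Fin n → List.Vector ℕ m →. ℕ}
    (hf : Computes f) (hg : ∀ i, Computes (g i)) :
    Computes fun v => (List.Vector.mOfFn fun i => g i v) >>= f := by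
  intro args b hb
  obtain ⟨P, hP⟩ := exists_mOfFn hg hb
  obtain ⟨Q, hQ⟩ := hf (fun i => b + i) (b + n + 1) fun i => by omega
  refine ⟨seq P (seq Q (move (b + n + 1) b)), fun s v hv => (hP s v hv).seq fun w u hu => ?_⟩
  rw [← Part.bind_some_right (f w)]
  refine (hQ u w hu.1).seq fun y t ht => (ensures_move (by omega)).returns fun t' ht' => ?_
  grind

theorem Computes.prec {n : ℕ} {f : List.Vector ℕ n → ℕ} {g : List.Vector ℕ (n + 2) → ℕ}
    (hf : Computes (f : List.Vector ℕ n →. ℕ)) (hg : Computes (g : List.Vector ℕ (n + 2) →. ℕ)) :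
    Computes ((fun v : List.Vector ℕ (n + 1) =>
      v.head.rec (f v.tail) fun y IH => g (y ::ᵥ IH ::ᵥ v.tail) :
        List.Vector ℕ (n + 1) → ℕ) : List.Vector ℕ (n + 1) →. ℕ) := by
  intro args b hb
  have hb0 := hb 0
  obtain ⟨P, hP⟩ := hf (fun i => args i.succ) b fun i => hb i.succ
  obtain ⟨Q, hQ⟩ := hg (Fin.cons (b + 1) (Fin.cons b fun i => args i.succ)) (b + 3)
    (Fin.cases (by simp) (Fin.cases (by simp) fun i => (hb i.succ).trans (by omega)))
  refine ⟨seq P (seq (clear (b + 1)) (seq (copy (args 0) (b + 2) (b + 3))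
    (loop (b + 2) (seq Q (seq (move (b + 3) b) (act (.inc (b + 1)))))))), fun s v hv => ?_⟩
  obtain ⟨F, hF0, hFsucc, hF⟩ : ∃ F : ℕ → ℕ, F 0 = f v.tail ∧
      (∀ k, F (k + 1) = g (k ::ᵥ F k ::ᵥ v.tail)) ∧
      F v.head = v.head.rec (f v.tail) fun y IH => g (y ::ᵥ IH ::ᵥ v.tail) :=
    ⟨fun k => k.rec (f v.tail) fun y IH => g (y ::ᵥ IH ::ᵥ v.tail), rfl, fun _ => rfl, rfl⟩
  have htail (u : Registers) (hu : ∀ r < b, u r = s r) (i : Fin n) :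
      u (args i.succ) = v.tail.get i := by
    rw [hu _ (hb i.succ), hv, List.Vector.get_tail_succ]
  have hhead : s (args 0) = v.head := by rw [hv, List.Vector.get_zero]
  let I (k : ℕ) (u : Registers) : Prop :=
    u b = F k ∧ u (b + 1) = k ∧ u (b + 2) = v.head - k ∧ ∀ r < b, u r = s r
  have body (k : ℕ) (u : Registers) (hu : I k (u + Pi.single (b + 2) 1)) :
      (seq Q (seq (move (b + 3) b) (act (.inc (b + 1))))).Ensures u (I (k + 1)) := by
    simp only [I, Pi.add_apply, Pi.single_apply] at hu
    have hk : u (b + 1) = k := by grind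
    have hFk : u b = F k := by grind
    have hut : ∀ r < b, u r = s r := by grind
    refine (hQ u (k ::ᵥ F k ::ᵥ v.tail) (Fin.forall_fin_succ.2
      ⟨hk, Fin.forall_fin_succ.2 ⟨hFk, htail u hut⟩⟩)).ensures.seq fun u₁ h₁ =>
      (ensures_move (by omega)).seq fun u₂ h₂ => (ensures_inc _).mono fun _ t ht => ?_
    simp only [I, ht, Pi.add_apply, Pi.single_apply, hFsucc]
    grind
  refine (hP s v.tail (htail s fun _ _ => rfl)).ensures.seq fun u₁ h₁ =>
    (ensures_clear (b + 1)).seq fun u₂ h₂ =>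
    (ensures_copy (by omega) (by omega) (by omega)).seq fun u₃ h₃ => ?_
  have start : I 0 u₃ := ⟨by grind, by grind, by grind, by grind⟩
  have rounds : u₃ (b + 2) = v.head := start.2.2.1
  refine (Ensures.loop start (fun k u hu => rounds ▸ hu.2.2.1) body).returns fun t ht => ?_
  rw [rounds] at ht
  exact ⟨ht.1.trans hF, ht.2.2.2⟩

theorem Computes.rfind {n : ℕ} {f : List.Vector ℕ (n + 1) → ℕ}
    (hf : Computes (f : List.Vector ℕ (n + 1) →. ℕ)) :
    Computes fun v => Nat.rfind fun k => Part.some (decide (f (k ::ᵥ v) = 0)) := by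
  intro args b hb
  obtain ⟨P, hP⟩ := hf (Fin.cons b args) (b + 1)
    (Fin.cases (by simp) fun i => (hb i).trans b.lt_succ_self)
  refine ⟨seq (clear b) (seq P (loop (b + 1) (seq (act (.inc b)) P))), fun s v hv => ?_⟩
  let I (k : ℕ) (u : Registers) : Prop :=
    u b = k ∧ u (b + 1) = f (k ::ᵥ v) ∧ ∀ r < b, u r = s r
  have search (k : ℕ) (u : Registers) (hk : u b = k) (hu : ∀ r < b, u r = s r) :
      P.Ensures u (I k) := by
    have hargs := hP u (k ::ᵥ v) <| Fin.cases (by simpa) fun i => by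
      simpa using (hu _ (hb i)).trans (hv i)
    exact hargs.ensures.mono fun _ t ht => ⟨by grind, ht.1, by grind⟩
  have body (k : ℕ) (u : Registers) (hu : I k (u + Pi.single (b + 1) 1)) :
      (seq (act (.inc b)) P).Ensures u (I (k + 1)) := by
    simp only [I, Pi.add_apply, Pi.single_apply] at hu
    refine (ensures_inc b).seq fun t ht => search (k + 1) t ?_ ?_
    all_goals simp only [ht, Pi.add_apply, Pi.single_apply]; grind
  refine (ensures_clear b).seq fun u₁ h₁ =>
    (search 0 u₁ h₁.1 fun r hr => h₁.2 r hr.ne).seq fun u₂ h₂ => ?_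
  exact (Returns.loop h₂ (fun k u hu => hu.2.1) body).mono fun k t ht => ⟨ht.1, ht.2.2⟩

theorem computes_of_primrec' {n : ℕ} {f : List.Vector ℕ n → ℕ} (hf : Nat.Primrec' f) :
    Computes (f : List.Vector ℕ n →. ℕ) := by
  induction hf with
  | zero => exact computes_zero
  | succ => exact computes_succ
  | get i => exact computes_get i
  | comp g _ _ hf hg =>
    refine (congrArg Computes (funext fun v => ?_)).mp (hf.comp hg)
    simp only [PFun.coe_val, Vector.mOfFn_part_some]
    exact Part.bind_some _ _
  | prec _ _ hf hg => exact hf.prec hg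

theorem computes_of_partrec' {n : ℕ} {f : List.Vector ℕ n →. ℕ} (hf : Nat.Partrec' f) :
    Computes f := by
  induction hf with
  | prim hf => exact computes_of_primrec' hf
  | comp g _ _ hf hg => exact hf.comp hg
  | rfind _ hf => exact hf.rfind

theorem exists_program_iff_dom {f : ℕ →. ℕ} (hf : Partrec f) :
    ∃ P : CounterProgram, ∀ a, (∃ t, P.Sem (Pi.single 0 a) t) ↔ (f a).Dom := by
  obtain ⟨P, hP⟩ := computes_of_partrec' (Nat.Partrec'.part_iff₁.2 hf) (fun _ => 0) 1
    fun _ => Nat.zero_lt_one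
  refine ⟨P, fun a => ?_⟩
  obtain ⟨hsound, hcomplete⟩ := hP (Pi.single 0 a) (a ::ᵥ .nil) (by simp)
  refine ⟨fun ⟨t, ht⟩ => ?_, hcomplete⟩
  obtain ⟨y, hy, -⟩ := hsound t ht
  exact Part.dom_iff_mem.2 ⟨y, hy⟩

theorem exists_not_computablePred_sem :
    ∃ P : CounterProgram, ¬ ComputablePred fun a => ∃ t, P.Sem (Pi.single 0 a) t := by
  have heval : Partrec fun n : ℕ => (Denumerable.ofNat Nat.Partrec.Code n).eval 0 :=
    Nat.Partrec.Code.eval_part.comp (.ofNat _) (.const 0)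
  obtain ⟨P, hP⟩ := exists_program_iff_dom heval
  refine ⟨P, fun h => ComputablePred.halting_problem 0 ?_⟩
  refine ComputablePred.computable_of_manyOneReducible ⟨_, Computable.encode, fun c => ?_⟩ h
  rw [hP, Denumerable.ofNat_encode]

/-- An edge of a control-flow graph. Its vertices are continuations, that is, lists of programs
that remain to be run. -/
abbrev Edge : Type := List CounterProgram × CounterInstr × List CounterProgram

/-- The control-flow graph of a program that is followed by a continuation. -/
def edges : CounterProgram → List CounterProgram → List Edge
  | act a, K => [(act a :: K, a, K)]
  | seq P Q, K => (seq P Q :: K, .skip, P :: Q :: K) :: (edges P (Q :: K) ++ edges Q K)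
  | star P, K => (star P :: K, .skip, K) :: (star P :: K, .skip, P :: star P :: K) ::
      edges P (star P :: K)

/-- One step in a control-flow graph. -/
def Step (E : List Edge) (x y : List CounterProgram × Registers) : Prop :=
  ∃ a, (x.1, a, y.1) ∈ E ∧ a.Exec x.2 y.2

/-- The input-output relation of a continuation. -/
def ContSem : List CounterProgram → Registers → Registers → Prop
  | [] => fun s t => t = s
  | P :: K => Comp P.Sem (ContSem K)

theorem reflTransGen_step_mono {E E' : List Edge} (h : E ⊆ E')
    {x y : List CounterProgram × Registers} (hxy : ReflTransGen (Step E) x y) :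
    ReflTransGen (Step E') x y :=
  ReflTransGen.mono (fun _ _ ⟨a, ha, hexec⟩ => ⟨a, h ha, hexec⟩) _ _ hxy

theorem ContSem.of_mem_edges {P : CounterProgram} {K K₁ K₂ : List CounterProgram}
    {a : CounterInstr} (h : (K₁, a, K₂) ∈ edges P K) {s u t : Registers} (hs : a.Exec s u)
    (hu : ContSem K₂ u t) : ContSem K₁ s t := by
  induction P generalizing K with
  | act b =>
    simp only [edges, List.mem_singleton, Prod.mk.injEq] at h
    obtain ⟨rfl, rfl, rfl⟩ := h
    exact ⟨u, hs, hu⟩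
  | seq P Q ihP ihQ =>
    simp only [edges, List.mem_cons, List.mem_append, Prod.mk.injEq] at h
    rcases h with ⟨rfl, rfl, rfl⟩ | h | h
    · obtain rfl : u = s := hs
      obtain ⟨v, hv, w, hw, ht⟩ := hu
      exact ⟨w, ⟨v, hv, hw⟩, ht⟩
    · exact ihP h
    · exact ihQ h
  | star P ih =>
    simp only [edges, List.mem_cons, Prod.mk.injEq] at h
    rcases h with ⟨rfl, rfl, rfl⟩ | ⟨rfl, rfl, rfl⟩ | h
    · obtain rfl : u = s := hs
      exact ⟨u, .refl, hu⟩
    · obtain rfl : u = s := hs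
      obtain ⟨v, hv, w, hw, ht⟩ := hu
      exact ⟨w, .head hv hw, ht⟩
    · exact ih h

theorem Sem.exists_path {P : CounterProgram} {K : List CounterProgram} {s t : Registers}
    (h : P.Sem s t) : ReflTransGen (Step (edges P K)) (P :: K, s) (K, t) := by
  induction P generalizing K s t with
  | act a => exact .single ⟨a, by simp [edges], h⟩
  | seq P Q ihP ihQ =>
    obtain ⟨u, hP, hQ⟩ := h
    refine .head (b := (P :: Q :: K, s)) ⟨.skip, by simp [edges], rfl⟩
      (.trans (b := (Q :: K, u)) ?_ ?_)
    · exact reflTransGen_step_mono (fun _ he => by simp [edges, he]) (ihP hP)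
    · exact reflTransGen_step_mono (fun _ he => by simp [edges, he]) (ihQ hQ)
  | star P ih =>
    have h' : ReflTransGen P.Sem s t := h
    induction h' using ReflTransGen.head_induction_on with
    | refl => exact .single ⟨.skip, by simp [edges], rfl⟩
    | @head s u hP hut ih' =>
      refine .head (b := (P :: star P :: K, s)) ⟨.skip, by simp [edges], rfl⟩
        (.trans (b := (star P :: K, u)) ?_ (ih' hut))
      exact reflTransGen_step_mono (fun _ he => by simp [edges, he]) (ih hP)

theorem reflTransGen_step_iff_sem {P : CounterProgram} {s t : Registers} :
    ReflTransGen (Step (edges P [])) ([P], s) ([], t) ↔ P.Sem s t := by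
  refine ⟨fun h => ?_, Sem.exists_path⟩
  have contSem (x) (hx : ReflTransGen (Step (edges P [])) x ([], t)) : ContSem x.1 x.2 t := by
    induction hx using ReflTransGen.head_induction_on with
    | refl => exact rfl
    | head hstep _ ih =>
      obtain ⟨a, ha, hexec⟩ := hstep
      exact .of_mem_edges ha hexec ih
  obtain ⟨u, hu, rfl⟩ := contSem _ h
  exact hu

end CounterProgram

/-- The least number `m` such that an instruction uses only the first `m` registers. -/
def CounterInstr.regBound : CounterInstr → ℕ
  | skip => 0
  | inc i | dec i | test i => i + 1

namespace CounterProgram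

/-- The least number `m` such that a program uses only the first `m` registers. -/
def regBound : CounterProgram → ℕ
  | act a => a.regBound
  | seq P Q => max P.regBound Q.regBound
  | star P => P.regBound

theorem regBound_drain_le (m : ℕ) : (drain m).regBound ≤ m := by
  induction m with
  | zero => exact le_rfl
  | succ m ih =>
    have hclear : (clear m).regBound = m + 1 := by
      simp [clear, pour, loop, incAll, regBound, CounterInstr.regBound]
    exact max_le (ih.trans m.le_succ) hclear.le

theorem regBound_le_of_mem_edges {P : CounterProgram} {K : List CounterProgram} {e : Edge}
    (he : e ∈ edges P K) : e.2.1.regBound ≤ P.regBound := by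
  induction P generalizing K with
  | act a =>
    obtain rfl := List.mem_singleton.1 he
    exact le_rfl
  | seq P Q ihP ihQ =>
    simp only [edges, List.mem_cons, List.mem_append] at he
    rcases he with rfl | he | he
    exacts [Nat.zero_le _, le_max_of_le_left (ihP he), le_max_of_le_right (ihQ he)]
  | star P ih =>
    simp only [edges, List.mem_cons] at he
    rcases he with rfl | rfl | he
    exacts [Nat.zero_le _, Nat.zero_le _, ih he]

end CounterProgram

section Matrices

open Matrix

theorem renameMatrix_mulVec {k : ℕ} (A : Matrix (Fin k) (Fin k) ℤ) (σ : Equiv.Perm (Fin k))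
    (v : Fin k → ℤ) : renameMatrix A σ *ᵥ v = (A *ᵥ (v ∘ ⇑σ⁻¹)) ∘ σ := by
  rw [renameMatrix, ← mulVec_mulVec, ← mulVec_mulVec, permMatrix_mulVec, permMatrix_mulVec]

theorem extendMatrix_mulVec_append {k n : ℕ} (A : Matrix (Fin k) (Fin k) ℤ) (u : Fin k → ℤ)
    (v : Fin n → ℤ) : extendMatrix A n *ᵥ Fin.append u v = Fin.append (A *ᵥ u) v := by
  ext x
  cases x using Fin.addCases <;>
    simp [extendMatrix, mulVec, dotProduct, Fin.sum_univ_add, one_apply]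

variable {k m : ℕ} {A : Matrix (Fin k) (Fin k) ℤ} {i₀ j : Fin k}

theorem append_zero_comp_swap (j : Fin k) (i : Fin m) (v : Fin m → ℤ) :
    Fin.append (0 : Fin k → ℤ) v ∘ Equiv.swap (Fin.castAdd m j) (Fin.natAdd k i) =
      Fin.append (Pi.single j (v i)) (Function.update v i 0) := by
  rw [Equiv.comp_swap_eq_update]
  have hne (x : Fin m) : Fin.natAdd k x ≠ Fin.castAdd m j := fun h => by
    have := congrArg Fin.val h
    simp only [Fin.val_natAdd, Fin.val_castAdd] at this
    omega
  ext x
  cases x using Fin.addCases <;> simp [Function.update_apply, Pi.single_apply, hne]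

/-- The matrix `A` acting on the first `k` counters, except that counter `k + i` plays the role of
counter `j`. -/
def testMatrix (A : Matrix (Fin k) (Fin k) ℤ) (j : Fin k) (i : Fin m) :
    Matrix (Fin (k + m)) (Fin (k + m)) ℤ :=
  renameMatrix (extendMatrix A m) (Equiv.swap (Fin.castAdd m j) (Fin.natAdd k i))

theorem testMatrix_mulVec_append_zero (A : Matrix (Fin k) (Fin k) ℤ) (j : Fin k) (i : Fin m)
    (v : Fin m → ℤ) : testMatrix A j i *ᵥ Fin.append 0 v =
      Fin.append (A *ᵥ Pi.single j (v i)) (Function.update v i 0) ∘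
        Equiv.swap (Fin.castAdd m j) (Fin.natAdd k i) := by
  rw [testMatrix, renameMatrix_mulVec, Equiv.swap_inv, append_zero_comp_swap,
    extendMatrix_mulVec_append]

theorem testMatrix_mulVec_append_zero_of_eq_zero {i : Fin m} {v : Fin m → ℤ} (hv : v i = 0) :
    testMatrix A j i *ᵥ Fin.append 0 v = Fin.append 0 v := by
  have hupdate : Function.update v i 0 = v := by rw [← hv, Function.update_eq_self]
  rw [testMatrix_mulVec_append_zero, hv, Pi.single_zero, mulVec_zero, hupdate,
    append_zero_comp_swap, hv, Pi.single_zero, hupdate]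

theorem exists_testMatrix_mulVec_append_zero_neg (hA : A i₀ j < 0) {i : Fin m} {v : Fin m → ℤ}
    (hv : 0 < v i) : ∃ x, (testMatrix A j i *ᵥ Fin.append 0 v) x < 0 := by
  refine ⟨Equiv.swap (Fin.castAdd m j) (Fin.natAdd k i) (Fin.castAdd m i₀), ?_⟩
  rw [testMatrix_mulVec_append_zero]
  simpa [mul_comm] using mul_neg_of_neg_of_pos hA hv

/-- The counter values that represent registers: `k` zeros, then the first `m` registers. -/
def stateVec (k m : ℕ) (s : Registers) : Fin (k + m) → ℤ :=
  Fin.append 0 fun i : Fin m => (s i : ℤ)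

theorem stateVec_natAdd (s : Registers) (i : Fin m) : stateVec k m s (Fin.natAdd k i) = s i :=
  Fin.append_right ..

theorem stateVec_nonneg (s : Registers) (x : Fin (k + m)) : 0 ≤ stateVec k m s x := by
  cases x using Fin.addCases <;> simp [stateVec]

theorem stateVec_add (s t : Registers) :
    stateVec k m (s + t) = stateVec k m s + stateVec k m t := by
  ext x
  cases x using Fin.addCases <;> simp [stateVec]

theorem stateVec_eq_iff {s t : Registers} :
    stateVec k m s = stateVec k m t ↔ ∀ r < m, s r = t r := by
  refine ⟨fun h r hr => ?_, fun h => ?_⟩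
  · simpa only [stateVec_natAdd, Nat.cast_inj] using congrFun h (Fin.natAdd k ⟨r, hr⟩)
  · simp only [stateVec, h _ (Fin.is_lt _)]

namespace CounterInstr

/-- The matrix of the transition that simulates an instruction on the vectors `stateVec k m s`;
for tests of registers that are not among the first `m`, the identity matrix. -/
def mat (A : Matrix (Fin k) (Fin k) ℤ) (j : Fin k) (m : ℕ) :
    CounterInstr → Matrix (Fin (k + m)) (Fin (k + m)) ℤ
  | test i => if h : i < m then testMatrix A j ⟨i, h⟩ else 1
  | _ => 1

/-- The vector of the transition that simulates an instruction. -/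
def vec (k m : ℕ) : CounterInstr → Fin (k + m) → ℤ
  | inc i => stateVec k m (Pi.single i 1)
  | dec i => -stateVec k m (Pi.single i 1)
  | _ => 0

theorem exec_dec_iff {i : ℕ} (hi : i < m) {s : Registers} {w : Fin (k + m) → ℤ} :
    ((∀ x, 0 ≤ w x) ∧ w = stateVec k m s - stateVec k m (Pi.single i 1)) ↔
      ∃ t, (dec i).Exec s t ∧ w = stateVec k m t := by
  constructor
  · rintro ⟨hw, rfl⟩
    have hsi : 1 ≤ s i := by
      simpa only [Pi.sub_apply, stateVec_natAdd, Pi.single_eq_same, sub_nonneg, Nat.cast_le]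
        using hw (Fin.natAdd k ⟨i, hi⟩)
    obtain ⟨t, rfl⟩ := exists_exec_dec hsi
    exact ⟨t, rfl, by rw [stateVec_add, add_sub_cancel_right]⟩
  · rintro ⟨t, rfl, rfl⟩
    exact ⟨stateVec_nonneg t, by rw [stateVec_add, add_sub_cancel_right]⟩

theorem exec_test_iff (hA : A i₀ j < 0) (i : Fin m) {s : Registers} {w : Fin (k + m) → ℤ} :
    ((∀ x, 0 ≤ w x) ∧ w = testMatrix A j i *ᵥ stateVec k m s) ↔
      ∃ t, (test i).Exec s t ∧ w = stateVec k m t := by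
  constructor
  · rintro ⟨hw, rfl⟩
    have hsi : s i = 0 := by
      by_contra hne
      obtain ⟨x, hx⟩ := exists_testMatrix_mulVec_append_zero_neg hA (i := i)
        (v := fun r => (s r : ℤ)) (mod_cast Nat.pos_of_ne_zero hne)
      exact (hw x).not_gt hx
    exact ⟨s, ⟨hsi, rfl⟩, testMatrix_mulVec_append_zero_of_eq_zero (mod_cast hsi)⟩
  · rintro ⟨t, ⟨hti, rfl⟩, rfl⟩
    exact ⟨stateVec_nonneg t, (testMatrix_mulVec_append_zero_of_eq_zero (mod_cast hti)).symm⟩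

theorem exec_iff (hA : A i₀ j < 0) {a : CounterInstr} (ha : a.regBound ≤ m) {s : Registers}
    {w : Fin (k + m) → ℤ} :
    ((∀ x, 0 ≤ w x) ∧ w = a.mat A j m *ᵥ stateVec k m s + a.vec k m) ↔
      ∃ t, a.Exec s t ∧ w = stateVec k m t := by
  have and_nonneg (t : Registers) :
      ((∀ x, 0 ≤ w x) ∧ w = stateVec k m t) ↔ w = stateVec k m t :=
    and_iff_right_of_imp fun h => h ▸ stateVec_nonneg t
  cases a with
  | skip => simp [mat, vec, Exec, and_nonneg]
  | inc i => simp [mat, vec, Exec, ← stateVec_add, and_nonneg]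
  | dec i => simpa [mat, vec, sub_eq_add_neg] using exec_dec_iff ha
  | test i =>
    have hi : i < m := ha
    simpa [mat, vec, hi] using exec_test_iff hA ⟨i, hi⟩

end CounterInstr

end Matrices

theorem reflTransGen_map_iff {α β : Type*} {r : α → α → Prop} {p : β → β → Prop} {f : α → β}
    (h : ∀ a b, p (f a) b ↔ ∃ a', r a a' ∧ f a' = b) {a : α} {b : β} :
    ReflTransGen p (f a) b ↔ ∃ a', ReflTransGen r a a' ∧ f a' = b := by
  constructor
  · intro hab
    induction hab with
    | refl => exact ⟨a, .refl, rfl⟩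
    | tail _ hstep ih =>
      obtain ⟨a₁, ha₁, rfl⟩ := ih
      obtain ⟨a₂, ha₂, rfl⟩ := (h a₁ _).1 hstep
      exact ⟨a₂, ha₁.tail ha₂, rfl⟩
  · rintro ⟨a', haa', rfl⟩
    exact haa'.lift f fun x y hxy => (h x (f y)).2 ⟨y, hxy, rfl⟩

namespace CounterProgram

/-- The vertices of the control-flow graph of a program: the final one and those that edges
leave. -/
def vertices (P : CounterProgram) : List (List CounterProgram) :=
  [] :: (edges P []).map Prod.fst

/-- A numbering of the vertices of the control-flow graph of a program. All other continuations
share the number `P.vertices.length`. -/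
def label (P : CounterProgram) (K : List CounterProgram) : Fin (P.vertices.length + 1) :=
  ⟨P.vertices.idxOf K, Nat.lt_succ_of_le List.idxOf_le_length⟩

theorem label_inj {P : CounterProgram} {K K' : List CounterProgram} (hK : K ∈ P.vertices) :
    P.label K = P.label K' ↔ K = K' := by
  rw [label, label, Fin.mk.injEq, List.idxOf_inj hK]

section Simulation

variable {k : ℕ} {A : Matrix (Fin k) (Fin k) ℤ} {i₀ j : Fin k} {P : CounterProgram}
  {s : Registers}

/-- The configuration that represents a vertex of the control-flow graph and registers. -/
def configuration (k : ℕ) (P : CounterProgram) (x : List CounterProgram × Registers) :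
    Configuration (k + P.regBound) (Fin (P.vertices.length + 1)) :=
  (P.label x.1, stateVec k P.regBound x.2)

/-- The transition that simulates an edge of the control-flow graph. -/
def edgeTransition (A : Matrix (Fin k) (Fin k) ℤ) (j : Fin k) (P : CounterProgram) (e : Edge) :
    Transition (k + P.regBound) (Fin (P.vertices.length + 1)) :=
  ⟨P.label e.1, e.2.1.mat A j P.regBound, e.2.1.vec k P.regBound, P.label e.2.2⟩

/-- The question whether a program that is started in `s` can end with all its registers zero, as
an input of the reachability problem. -/
def reachInput (A : Matrix (Fin k) (Fin k) ℤ) (j : Fin k) (P : CounterProgram) (s : Registers) :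
    ReachInput where
  dim := k + P.regBound
  dim_pos := le_add_right j.pos
  numStates := P.vertices.length + 1
  transitionList := (edges P []).map (edgeTransition A j P)
  source := configuration k P ([P], s)
  target := configuration k P ([], 0)

theorem nStep_configuration_iff (hA : A i₀ j < 0) (x : List CounterProgram × Registers)
    (c : Configuration (k + P.regBound) (Fin (P.vertices.length + 1))) :
    (reachInput A j P s).vass.NStep (configuration k P x) c ↔
      ∃ y, Step (edges P []) x y ∧ configuration k P y = c := by
  have exec_iff {e : Edge} (he : e ∈ edges P []) :=
    CounterInstr.exec_iff hA (regBound_le_of_mem_edges he) (s := x.2) (w := c.2)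
  constructor
  · rintro ⟨_, ht, -, hc, hsrc, htgt, heq⟩
    obtain ⟨⟨K, a, K'⟩, he, rfl⟩ := List.mem_map.1 ht
    obtain rfl : K = x.1 := (label_inj (.tail _ (List.mem_map_of_mem he))).1 hsrc
    obtain ⟨t, hexec, hct⟩ := (exec_iff he).1 ⟨hc, heq⟩
    exact ⟨(K', t), ⟨a, he, hexec⟩, Prod.ext htgt hct.symm⟩
  · rintro ⟨y, ⟨a, he, hexec⟩, rfl⟩
    obtain ⟨hc, heq⟩ := (exec_iff he).2 ⟨y.2, hexec, rfl⟩
    exact ⟨edgeTransition A j P (x.1, a, y.1), List.mem_map_of_mem he, stateVec_nonneg _, hc,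
      rfl, rfl, heq⟩

theorem reachInput_nReach_iff (hA : A i₀ j < 0) :
    (reachInput A j P s).vass.NReach (reachInput A j P s).source (reachInput A j P s).target ↔
      ∃ t, P.Sem s t ∧ ∀ r < P.regBound, t r = 0 := by
  refine (reflTransGen_map_iff (nStep_configuration_iff hA)).trans ?_
  constructor
  · rintro ⟨⟨K, t⟩, hpath, hKt⟩
    obtain ⟨hK, ht⟩ := Prod.ext_iff.1 hKt
    obtain rfl : [] = K := (label_inj (.head _)).1 hK.symm
    exact ⟨t, reflTransGen_step_iff_sem.1 hpath, stateVec_eq_iff.1 ht⟩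
  · rintro ⟨t, hst, ht⟩
    exact ⟨([], t), reflTransGen_step_iff_sem.2 hst, Prod.ext rfl (stateVec_eq_iff.2 ht)⟩

theorem reachInput_nReach_seq_drain_iff (hA : A i₀ j < 0) :
    let I := reachInput A j (seq P (drain P.regBound)) s
    I.vass.NReach I.source I.target ↔ ∃ t, P.Sem s t := by
  have hbound : (seq P (drain P.regBound)).regBound = P.regBound :=
    max_eq_left (regBound_drain_le _)
  simp only [reachInput_nReach_iff hA, hbound]
  constructor
  · rintro ⟨-, ⟨u, hu, -⟩, -⟩
    exact ⟨u, hu⟩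
  · rintro ⟨u, hu⟩
    obtain ⟨hzero, t, ht⟩ := ensures_iff.1 (ensures_drain (s := u) P.regBound)
    exact ⟨t, ⟨u, hu, ht⟩, hzero t ht⟩

theorem reachInput_belongsTo {C : (k : ℕ) → Set (Matrix (Fin k) (Fin k) ℤ)}
    (hrename : ∀ {k : ℕ} {A : Matrix (Fin k) (Fin k) ℤ}, A ∈ C k →
      ∀ σ : Equiv.Perm (Fin k), renameMatrix A σ ∈ C k)
    (hextend : ∀ {k : ℕ} {A : Matrix (Fin k) (Fin k) ℤ}, A ∈ C k →
      ∀ n : ℕ, 1 ≤ n → extendMatrix A n ∈ C (k + n))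
    (hone : ∀ n : ℕ, 1 ≤ n → (1 : Matrix (Fin n) (Fin n) ℤ) ∈ C n) (hA : A ∈ C k) :
    (reachInput A j P s).vass.BelongsTo C := by
  intro t ht
  obtain ⟨⟨K, a, K'⟩, -, rfl⟩ := List.mem_map.1 ht
  have one_mem := hone (k + P.regBound) (le_add_right j.pos)
  change a.mat A j P.regBound ∈ C (k + P.regBound)
  cases a with
  | test i =>
    simp only [CounterInstr.mat]
    split_ifs with hi
    · exact hrename (hextend hA _ (Nat.one_le_of_lt hi)) _
    · exact one_mem
  | _ => exact one_mem

theorem primrec_intCast : Primrec ((↑) : ℕ → ℤ) := by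
  rw [← Primrec.encode_iff]
  exact Primrec.nat_mul.comp (.const 2) .id

theorem primrec_reachInput_code {α : Type*} [Primcodable α] {s : α → Registers}
    (hs : ∀ r, Primrec fun a => s a r) : Primrec fun a => (reachInput A j P (s a)).code := by
  have hvec : Primrec fun a => List.ofFn (stateVec k P.regBound (s a)) :=
    Primrec.list_ofFn fun x => by
      cases x using Fin.addCases with
      | left x => simpa [stateVec] using Primrec.const 0
      | right i => simpa [stateVec] using primrec_intCast.comp (hs i)
  have hsource : Primrec fun a => configurationCode (configuration k P ([P], s a)) :=
    (Primrec.const (P.label [P] : ℕ)).pair hvec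
  exact (Primrec.const (k + P.regBound)).pair <| (Primrec.const (P.vertices.length + 1)).pair <|
    (Primrec.const (((edges P []).map (edgeTransition A j P)).map Transition.code)).pair <|
    hsource.pair (Primrec.const (configurationCode (configuration k P ([], 0))))

end Simulation

end CounterProgram

theorem DecidableProblem.computablePred {ι κ α : Type*} [Primcodable κ] [Primcodable α]
    {code : ι → κ} {IsInput Yes : ι → Prop} (h : DecidableProblem code IsInput Yes) {g : α → ι}
    (hg : Computable fun a => code (g a)) (hin : ∀ a, IsInput (g a)) :
    ComputablePred fun a => Yes (g a) := by
  obtain ⟨f, hf, hdec⟩ := h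
  choose b hb hbYes using fun a => hdec (g a) (hin a)
  have hcomp : Computable b := (hf.comp hg).of_eq fun a => Part.eq_some_iff.2 (hb a)
  exact ComputablePred.computable_iff.2 ⟨b, hcomp, funext fun a => propext (hbYes a).symm⟩

theorem proposition4p3_general (C : (k : ℕ) → Set (Matrix (Fin k) (Fin k) ℤ))
    (hrename : ∀ {k : ℕ} {A : Matrix (Fin k) (Fin k) ℤ}, A ∈ C k →
      ∀ σ : Equiv.Perm (Fin k), renameMatrix A σ ∈ C k)
    (hextend : ∀ {k : ℕ} {A : Matrix (Fin k) (Fin k) ℤ}, A ∈ C k →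
      ∀ n : ℕ, 1 ≤ n → extendMatrix A n ∈ C (k + n))
    (hone : ∀ n : ℕ, 1 ≤ n → (1 : Matrix (Fin n) (Fin n) ℤ) ∈ C n)
    (hneg : ∃ (k : ℕ) (A : Matrix (Fin k) (Fin k) ℤ), A ∈ C k ∧ ∃ i j : Fin k, A i j < 0) :
    ¬ ReachDecidable C := by
  intro hdec
  obtain ⟨k, A, hAC, i₀, j, hA⟩ := hneg
  obtain ⟨P, hP⟩ := CounterProgram.exists_not_computablePred_sem
  have hinput (r : ℕ) : Primrec fun a => (Pi.single 0 a : Registers) r := by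
    cases r with
    | zero => exact Primrec.id
    | succ r => exact Primrec.const 0
  have hreach := hdec.computablePred
    (g := fun a => CounterProgram.reachInput A j (.seq P (.drain P.regBound)) (Pi.single 0 a))
    (CounterProgram.primrec_reachInput_code hinput).to_comp
    fun _ => CounterProgram.reachInput_belongsTo hrename hextend hone hAC
  exact hP (hreach.of_eq fun _ => CounterProgram.reachInput_nReach_seq_drain_iff hA)

theorem proposition4p3 (C : (k : ℕ) → Set (Matrix (Fin k) (Fin k) ℤ)) (hC : IsMatrixClass C)
    (hneg : ∃ (k : ℕ) (A : Matrix (Fin k) (Fin k) ℤ), A ∈ C k ∧ ∃ i j : Fin k, A i j < 0) :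
    ¬ ReachDecidable C :=
  proposition4p3_general C hC.rename_mem hC.extend_mem hC.one_mem hneg
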